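/- For a positive integer $n$ let $\Omega(n)$ denote the number of prime factors of $n$ counted with multiplicity (so $\Omega(1)=0$), and for real $x$ put $$S(x)=\sum_{1\le n\le x}(-1)^{n-\Omega(n)},\qquad T(x)=\sum_{1\le n\le x}\frac{(-1)^{n-\Omega(n)}}{n}.$$ (i) We have $S(x)=o(x)$ as $x\to\infty$, and the series $\sum_{n=1}^\infty \frac{(-1)^{n-\Omega(n)}}{n}$ converges (as the limit of its partial sums) with $$\sum_{n=1}^\infty\frac{(-1)^{n-\Omega(n)}}{n}=0.$$ (ii) If $S(x)>0$ for all real $x\ge 5$, or if $T(x)<0$ for all real $x\ge 1$, then the Riemann Hypothesis holds, that is, every zero of the Riemann zeta function $\zeta(s)$ other than the trivial zeros $s=-2,-4,-6,\ldots$ has real part $1/2$. -/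

import Mathlib

open scoped ArithmeticFunction.Omega Asymptotics

/-- The sign `(-1)^(n - Ω(n))`, the exponent being an integer and `Ω(n)` the number of prime
factors of `n` counted with multiplicity. -/
noncomputable def paritySign (n : ℕ) : ℝ := (-1 : ℝ) ^ ((n : ℤ) - (Ω n : ℤ))

/-- `S(x) = ∑_{1 ≤ n ≤ x} (-1)^(n - Ω(n))` for real `x`. -/
noncomputable def sumS (x : ℝ) : ℝ := ∑ n ∈ Finset.Icc 1 ⌊x⌋₊, paritySign n

/-- `T(x) = ∑_{1 ≤ n ≤ x} (-1)^(n - Ω(n)) / n` for real `x`. -/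
noncomputable def sumT (x : ℝ) : ℝ := ∑ n ∈ Finset.Icc 1 ⌊x⌋₊, paritySign n / (n : ℝ)

/-! ### The Liouville function and the Dirichlet series of the signs -/

section

open ArithmeticFunction

/-! With `λ` the Liouville function, the sign is `(-1)^n λ(n)`. Since `λ(2m) = -λ(m)`, its Dirichlet
series is `-(1 + 2^(1-s)) ζ(2s)/ζ(s)`, the Euler product giving `ζ(2s)/ζ(s)` for `λ`. Everything
follows from this quotient. It is written with the entire function `riemannZeta₁ s = (s - 1) ζ(s)`,
so that the pole at `1` causes no trouble.

(i) `T` is bounded, and `u ↦ T(exp u)` oscillates slowly. Its Laplace transform is `-(1 + 2^(-z))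
ζ(2z+2) / (z ζ(z+1))`, which is continuous up to `Re z = 0` because `ζ` has no zeros on `Re s = 1`.
The Tauberian theorem `tendsto_zero_of_laplace_continuousOn` gives `T → 0`; Abel summation and
Cesàro means then give `S(x) = o(x)`.

(ii) A sign condition makes `S(exp u) + 5` or `-T(exp u)` nonnegative. Its Laplace transform
continues analytically along the real axis down to the point corresponding to `s = 1/2`, as `ζ` has
no zeros on `(0, 1)`. By Landau's theorem `mem_integrableExpSet_of_analyticAt` the integral
converges, hence is holomorphic, on the whole half-plane. A zero of `ζ` with `1/2 < Re s < 1` would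
then have to be cancelled by `(1 + 2^(1-s)) ζ(2s)`, which does not vanish there. The functional
equation handles `Re s < 1/2`. -/

lemma paritySign_eq {n : ℕ} (hn : n ≠ 0) :
    paritySign n = (-1 : ℝ) ^ n * (liouville n : ℝ) := by
  rw [paritySign, liouville_apply hn, zpow_sub₀ (by norm_num)]
  simp only [zpow_natCast]
  push_cast
  rw [div_eq_mul_inv, ← inv_pow]
  norm_num

lemma abs_paritySign (n : ℕ) : |paritySign n| = 1 := by
  rw [paritySign, abs_zpow]; simp

lemma abs_liouville_le (n : ℕ) : |(liouville n : ℝ)| ≤ 1 := by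
  rcases eq_or_ne n 0 with rfl | hn
  · simp
  · simp [liouville_apply hn]

/-- The convolution `λ * 1` is multiplicative, and at `p^k` it is the alternating sum `1 - 1 + ⋯ ±
1`, which is `0` or `1`. -/
lemma abs_liouville_mul_zeta_le (n : ℕ) :
    |(liouville * (zeta : ArithmeticFunction ℤ)) n| ≤ 1 := by
  have hm : (liouville * (zeta : ArithmeticFunction ℤ)).IsMultiplicative :=
    isMultiplicative_liouville.mul isMultiplicative_zeta.natCast
  induction n using Nat.recOnPosPrimePosCoprime with
  | zero => simp
  | one => simp [hm.map_one]
  | prime_pow p k hp hk =>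
    rw [mul_comm, coe_zeta_mul_apply, Nat.sum_divisors_prime_pow hp]
    have : ∀ j ∈ Finset.range (k + 1), liouville (p ^ j) = (-1) ^ j := fun j _ => by
      rw [liouville_apply (pow_ne_zero _ hp.ne_zero), cardFactors_apply_prime_pow hp]
    rw [Finset.sum_congr rfl this, neg_one_geom_sum]
    split_ifs <;> simp
  | coprime a b ha hb hab iha ihb =>
    rw [hm.map_mul_of_coprime hab, abs_mul]
    exact mul_le_one₀ iha (abs_nonneg _) ihb

/-- The logarithmic partial sums of the Liouville function are bounded. -/
lemma abs_sum_liouville_div_le (N : ℕ) :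
    |∑ n ∈ Finset.Icc 1 N, (liouville n : ℝ) / n| ≤ 2 := by
  rcases eq_or_ne N 0 with rfl | hN
  · simp
  have hN' : (0 : ℝ) < N := by positivity
  -- Summing `λ * 1` up to `N` gives `∑ λ(n) ⌊N/n⌋`, which is at most `N` in size; replacing `⌊N/n⌋`
  -- by `N/n` costs at most `1` per term, so another `N`.
  have h1 : ∑ n ∈ Finset.Ioc 0 N, (liouville n : ℝ) * ((N / n : ℕ) : ℝ)
      = ∑ n ∈ Finset.Ioc 0 N, ((liouville * (zeta : ArithmeticFunction ℤ)) n : ℝ) := by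
    have := sum_Ioc_mul_zeta_eq_sum liouville N
    rw [← Int.cast_sum, this]
    push_cast
    rfl
  have h2 : |∑ n ∈ Finset.Ioc 0 N, (liouville n : ℝ) * ((N / n : ℕ) : ℝ)| ≤ N := by
    rw [h1]
    refine (Finset.abs_sum_le_sum_abs _ _).trans ?_
    refine (Finset.sum_le_sum (g := fun _ => (1 : ℝ)) fun n _ => ?_).trans (by simp)
    exact_mod_cast abs_liouville_mul_zeta_le n
  have h3 : |∑ n ∈ Finset.Ioc 0 N, (liouville n : ℝ) * ((N : ℝ) / n - ((N / n : ℕ) : ℝ))| ≤ N := by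
    refine (Finset.abs_sum_le_sum_abs _ _).trans ?_
    refine (Finset.sum_le_sum (g := fun _ => (1 : ℝ)) fun n _ => ?_).trans (by simp)
    rw [abs_mul]
    refine mul_le_one₀ (abs_liouville_le n) (abs_nonneg _) ?_
    rw [← Nat.floor_div_eq_div (K := ℝ), abs_of_nonneg (sub_nonneg.2 (Nat.floor_le (by positivity)))]
    linarith [Nat.lt_floor_add_one ((N : ℝ) / n)]
  have h4 : (N : ℝ) * ∑ n ∈ Finset.Icc 1 N, (liouville n : ℝ) / n =
      ∑ n ∈ Finset.Ioc 0 N, (liouville n : ℝ) * ((N : ℝ) / n - ((N / n : ℕ) : ℝ)) +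
      ∑ n ∈ Finset.Ioc 0 N, (liouville n : ℝ) * ((N / n : ℕ) : ℝ) := by
    rw [← Finset.sum_add_distrib, Finset.mul_sum]
    refine Finset.sum_congr rfl fun n _ => by ring
  have h5 : |(N : ℝ) * ∑ n ∈ Finset.Icc 1 N, (liouville n : ℝ) / n| ≤ N * 2 := by
    rw [h4]; exact (abs_add_le _ _).trans (by linarith)
  rw [abs_mul, abs_of_pos hN'] at h5
  exact le_of_mul_le_mul_left h5 hN'

/-- The sum equals `-∑ λ(n)/n` plus twice its even part, and `2 λ(2m)/(2m) = -λ(m)/m`. -/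
lemma sum_paritySign_div_eq (N : ℕ) :
    ∑ n ∈ Finset.Icc 1 N, paritySign n / n =
      -(∑ n ∈ Finset.Icc 1 N, (liouville n : ℝ) / n)
        - ∑ n ∈ Finset.Icc 1 (N / 2), (liouville n : ℝ) / n := by
  induction N with
  | zero => simp
  | succ N ih =>
    rw [Finset.sum_Icc_succ_top (by omega), Finset.sum_Icc_succ_top (by omega), ih,
      paritySign_eq (by omega)]
    rcases Nat.even_or_odd (N + 1) with h | h
    · rw [h.neg_one_pow]
      obtain ⟨m, hm⟩ := h
      have e1 : (N + 1) / 2 = N / 2 + 1 := by omega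
      have e2 : N / 2 + 1 = m := by omega
      have hm0 : (m : ℝ) ≠ 0 := by
        have : m ≠ 0 := by omega
        exact_mod_cast this
      rw [e1, Finset.sum_Icc_succ_top (by omega), e2]
      have e3 : N + 1 = 2 * m := by omega
      have e4 : liouville 2 = -1 := by
        rw [liouville_apply (by norm_num), cardFactors_apply_prime Nat.prime_two]; norm_num
      rw [e3, liouville_apply_mul, e4]
      push_cast
      field_simp
      ring
    · rw [h.neg_one_pow]
      obtain ⟨m, hm⟩ := h
      have e1 : (N + 1) / 2 = N / 2 := by omega
      rw [e1]; ring

lemma abs_sum_paritySign_div_le (N : ℕ) :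
    |∑ n ∈ Finset.Icc 1 N, paritySign n / n| ≤ 4 := by
  rw [sum_paritySign_div_eq, abs_le]
  have h1 := abs_le.1 (abs_sum_liouville_div_le N)
  have h2 := abs_le.1 (abs_sum_liouville_div_le (N / 2))
  constructor <;> linarith [h1.1, h1.2, h2.1, h2.2]

/-- The completely multiplicative function `n ↦ λ(n) n⁻ˢ`. -/
noncomputable def liouvilleSummandHom {s : ℂ} (_hs : s ≠ 0) : ℕ →*₀ ℂ where
  toFun n := (liouville n : ℂ) * (n : ℂ) ^ (-s)
  map_zero' := by simp
  map_one' := by simp [liouville_apply_one]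
  map_mul' m n := by
    rw [liouville_apply_mul, Nat.cast_mul, Complex.natCast_mul_natCast_cpow]
    push_cast; ring

lemma summable_liouvilleSummandHom {s : ℂ} (hs : 1 < s.re) :
    Summable (fun n => ‖liouvilleSummandHom (Complex.ne_zero_of_one_lt_re hs) n‖) := by
  refine (summable_riemannZetaSummand hs).of_nonneg_of_le (fun _ => norm_nonneg _) fun n => ?_
  simp only [liouvilleSummandHom, riemannZetaSummandHom, MonoidWithZeroHom.coe_mk, ZeroHom.coe_mk,
    norm_mul]
  refine mul_le_of_le_one_left (norm_nonneg _) ?_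
  have := abs_liouville_le n
  rw [Complex.norm_intCast]
  exact this

lemma term_liouville {s : ℂ} (hs : s ≠ 0) (n : ℕ) :
    LSeries.term (fun n => (liouville n : ℂ)) s n = liouvilleSummandHom hs n := by
  rw [LSeries.term_of_ne_zero' hs, liouvilleSummandHom]
  simp [Complex.cpow_neg, div_eq_mul_inv]

/-- Since `λ(p) = -1`, the Euler factors multiply as `(1 + p^(-s))⁻¹ (1 - p^(-s))⁻¹ = (1 -
p^(-2s))⁻¹`. -/
lemma LSeries_liouville_mul_riemannZeta {s : ℂ} (hs : 1 < s.re) :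
    LSeries (fun n => (liouville n : ℂ)) s * riemannZeta s = riemannZeta (2 * s) := by
  have hs0 := Complex.ne_zero_of_one_lt_re hs
  have h1 := EulerProduct.eulerProduct_completely_multiplicative_hasProd
    (summable_liouvilleSummandHom hs)
  have h2 := riemannZeta_eulerProduct_hasProd hs
  have h3 := riemannZeta_eulerProduct_hasProd (s := 2 * s) (by simp; linarith)
  rw [LSeries, tsum_congr (term_liouville hs0)]
  refine (h1.mul h2).unique ?_
  convert h3 using 2 with p
  have e1 : liouvilleSummandHom hs0 p = -(p : ℂ) ^ (-s) := by
    simp only [liouvilleSummandHom, MonoidWithZeroHom.coe_mk, ZeroHom.coe_mk]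
    rw [liouville_apply p.2.ne_zero, cardFactors_apply_prime p.2]
    simp
  have e2 : (p : ℂ) ^ (-(2 * s)) = (p : ℂ) ^ (-s) * (p : ℂ) ^ (-s) := by
    rw [← Complex.cpow_add _ _ (by exact_mod_cast p.2.ne_zero)]
    congr 1; ring
  rw [e1, e2, ← mul_inv]
  congr 1; ring

lemma term_paritySign_even (s : ℂ) (k : ℕ) :
    LSeries.term (fun n => (paritySign n : ℂ)) s (2 * k) =
      -(2 : ℂ) ^ (-s) * LSeries.term (fun n => (liouville n : ℂ)) s k := by
  rcases eq_or_ne k 0 with rfl | hk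
  · simp
  have hk2 : 2 * k ≠ 0 := by omega
  rw [LSeries.term_of_ne_zero hk2, LSeries.term_of_ne_zero hk, paritySign_eq hk2,
    liouville_apply_mul, liouville_apply (n := 2) (by norm_num),
    cardFactors_apply_prime Nat.prime_two, Nat.cast_mul, Complex.natCast_mul_natCast_cpow,
    Complex.cpow_neg]
  simp
  field_simp

lemma term_liouville_even (s : ℂ) (k : ℕ) :
    LSeries.term (fun n => (liouville n : ℂ)) s (2 * k) =
      LSeries.term (fun n => (paritySign n : ℂ)) s (2 * k) := by
  rcases eq_or_ne k 0 with rfl | hk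
  · simp
  have hk2 : 2 * k ≠ 0 := by omega
  rw [LSeries.term_of_ne_zero hk2, LSeries.term_of_ne_zero hk2, paritySign_eq hk2]
  simp

lemma term_paritySign_odd (s : ℂ) (k : ℕ) :
    LSeries.term (fun n => (paritySign n : ℂ)) s (2 * k + 1) =
      -LSeries.term (fun n => (liouville n : ℂ)) s (2 * k + 1) := by
  have hk2 : 2 * k + 1 ≠ 0 := by omega
  rw [LSeries.term_of_ne_zero hk2, LSeries.term_of_ne_zero hk2, paritySign_eq hk2]
  simp [pow_succ, neg_div]

lemma LSeriesSummable_liouville {s : ℂ} (hs : 1 < s.re) :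
    LSeriesSummable (fun n => (liouville n : ℂ)) s :=
  LSeriesSummable_of_bounded_of_one_lt_re (m := 1)
    (fun n _ => by rw [Complex.norm_intCast]; exact abs_liouville_le n) hs

lemma LSeriesSummable_paritySign {s : ℂ} (hs : 1 < s.re) :
    LSeriesSummable (fun n => (paritySign n : ℂ)) s :=
  LSeriesSummable_of_bounded_of_one_lt_re (m := 1)
    (fun n _ => by rw [Complex.norm_real, Real.norm_eq_abs, abs_paritySign]) hs

lemma LSeries_paritySign_eq {s : ℂ} (hs : 1 < s.re) :
    LSeries (fun n => (paritySign n : ℂ)) s =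
      -(1 + (2 : ℂ) ^ (1 - s)) * LSeries (fun n => (liouville n : ℂ)) s := by
  have hl := LSeriesSummable_liouville hs
  have hp := LSeriesSummable_paritySign hs
  have he : Function.Injective fun k : ℕ => 2 * k := fun a b h => by simpa using h
  have ho : Function.Injective fun k : ℕ => 2 * k + 1 := fun a b h => by simpa using h
  have h1 := tsum_even_add_odd (hl.comp_injective he) (hl.comp_injective ho)
  have h2 := tsum_even_add_odd (hp.comp_injective he) (hp.comp_injective ho)
  simp only [term_liouville_even, term_paritySign_odd, term_paritySign_even,
    tsum_neg, tsum_mul_left] at h1 h2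
  have h3 : (2 : ℂ) ^ (1 - s) = 2 * (2 : ℂ) ^ (-s) := by
    rw [sub_eq_add_neg, Complex.cpow_add _ _ (by norm_num), Complex.cpow_one]
  rw [h3]
  change _ = LSeries (fun n => (liouville n : ℂ)) s at h1
  change _ = LSeries (fun n => (paritySign n : ℂ)) s at h2
  change -(2 : ℂ) ^ (-s) * LSeries (fun n => (liouville n : ℂ)) s + _ = _ at h1
  change -(2 : ℂ) ^ (-s) * LSeries (fun n => (liouville n : ℂ)) s + _ = _ at h2
  -- The odd parts of the two series are opposite and cancel on adding; each even part is `-2^(-s)`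
  -- times the Liouville series.
  linear_combination -h1 - h2

lemma riemannZeta₁_eq {s : ℂ} (hs : s ≠ 1) : riemannZeta₁ s = (s - 1) * riemannZeta s := by
  rw [riemannZeta_eq_inv_sub_mul hs, mul_inv_cancel_left₀ (sub_ne_zero.2 hs)]

/-- The Dirichlet series of `paritySign` is `-(1 + 2 ^ (1 - s)) ζ(2 s) / ζ(s)`. -/
lemma riemannZeta₁_mul_LSeries_paritySign {s : ℂ} (hs : 1 < s.re) :
    riemannZeta₁ s * LSeries (fun n => (paritySign n : ℂ)) s =
      -((s - 1) * (1 + (2 : ℂ) ^ (1 - s)) * riemannZeta (2 * s)) := by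
  rw [LSeries_paritySign_eq hs, riemannZeta₁_eq (by rintro rfl; simp at hs),
    ← LSeries_liouville_mul_riemannZeta hs]
  ring

end

/-! ### Laplace transforms and Landau's theorem -/

section

open MeasureTheory Set Filter Topology ProbabilityTheory

lemma integral_Ioi_one_mul_cpow (φ : ℝ → ℂ) (s : ℂ) :
    ∫ t in Ioi (1 : ℝ), φ t * (t : ℂ) ^ (-(s + 1)) =
      ∫ u in Ioi (0 : ℝ), φ (Real.exp u) * Complex.exp (-s * u) := by
  have him : Real.exp '' Ioi 0 = Ioi 1 := by
    ext x
    constructor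
    · rintro ⟨u, hu, rfl⟩
      exact Real.one_lt_exp_iff.2 hu
    · intro hx
      exact ⟨Real.log x, Real.log_pos hx, Real.exp_log (zero_lt_one.trans hx)⟩
  rw [← him, integral_image_eq_integral_abs_deriv_smul measurableSet_Ioi
    (fun x _ => (Real.hasDerivAt_exp x).hasDerivWithinAt) Real.exp_injective.injOn]
  refine setIntegral_congr_fun measurableSet_Ioi fun u _ => ?_
  simp only [abs_of_pos (Real.exp_pos u), Complex.real_smul]
  have h0 : ((Real.exp u : ℝ) : ℂ) ≠ 0 := by exact_mod_cast (Real.exp_pos u).ne'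
  rw [Complex.cpow_def_of_ne_zero h0, ← Complex.ofReal_log (Real.exp_pos u).le, Real.log_exp,
    mul_left_comm, Complex.ofReal_exp, ← Complex.exp_add]
  congr 2; ring

/-- A Dirichlet series as the Laplace transform of its coefficient sums. -/
lemma LSeries_eq_mul_laplace {f : ℕ → ℝ} {r : ℝ} (hr : 0 ≤ r) {s : ℂ} (hs : r < s.re)
    (hf : LSeriesSummable (fun n => (f n : ℂ)) s)
    (hO : (fun n => ∑ k ∈ Finset.Icc 1 n, f k) =O[atTop] fun n : ℕ => (n : ℝ) ^ r) :
    LSeries (fun n => (f n : ℂ)) s =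
      s * ∫ u in Ioi (0 : ℝ),
        ((∑ k ∈ Finset.Icc 1 ⌊Real.exp u⌋₊, f k : ℝ) : ℂ) * Complex.exp (-s * u) := by
  rw [LSeries_eq_mul_integral _ hr hs hf,
    integral_Ioi_one_mul_cpow (fun t => ∑ k ∈ Finset.Icc 1 ⌊t⌋₊, (f k : ℂ))]
  · push_cast; rfl
  · refine Asymptotics.isBigO_norm_left.1 (hO.norm_left.congr_left fun n => ?_)
    rw [← Complex.ofReal_sum, Complex.norm_real]

lemma measurable_sum_floor (f : ℕ → ℝ) :
    Measurable fun x : ℝ => ∑ n ∈ Finset.Icc 1 ⌊x⌋₊, f n :=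
  (measurable_from_nat (f := fun N => ∑ n ∈ Finset.Icc 1 N, f n)).comp Nat.measurable_floor

/-- Landau's theorem: if the moment generating function of a nonpositive variable converges to the
right of `σ₁` and continues analytically along the real axis up to `σ₀`, it converges to the right
of `σ₀`. -/
theorem mem_integrableExpSet_of_analyticAt {α : Type*} {mα : MeasurableSpace α} {μ : Measure α}
    {X : α → ℝ} (hXm : AEMeasurable X μ) (hX : ∀ᵐ ω ∂μ, X ω ≤ 0) {σ₀ σ₁ : ℝ}
    (hint : ∀ σ, σ₁ < σ → σ ∈ integrableExpSet X μ)
    {H : ℂ → ℂ} (hH : ∀ σ : ℝ, σ₀ < σ → AnalyticAt ℂ H σ)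
    (hHeq : ∀ σ : ℝ, σ₁ < σ → complexMGF X μ σ = H σ) {σ : ℝ} (hσ : σ₀ < σ) :
    σ ∈ integrableExpSet X μ := by
  by_contra hnot
  set I := integrableExpSet X μ with hI
  have hup : ∀ a ∈ I, ∀ b, a ≤ b → b ∈ I := by
    intro a ha b hab
    refine integrable_exp_mul_of_le_of_le ha (hint (max b (σ₁ + 1)) ?_) hab (le_max_left _ _)
    exact (lt_add_one σ₁).trans_le (le_max_right _ _)
  have hlow : ∀ a ∈ I, σ ≤ a := fun a ha => by
    by_contra! h
    exact hnot (hup a ha σ h.le)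
  have hne : I.Nonempty := ⟨σ₁ + 1, hint _ (lt_add_one _)⟩
  have hbdd : BddBelow I := ⟨σ, hlow⟩
  set c := sInf I with hc
  have hσc : σ₀ < c := hσ.trans_le (le_csInf hne hlow)
  have hIoi : Ioi c ⊆ I := fun x hx => by
    obtain ⟨a, ha, hax⟩ := exists_lt_of_csInf_lt hne hx
    exact hup a ha x hax.le
  have hint' : Ioi c ⊆ interior I := interior_maximal hIoi isOpen_Ioi
  obtain ⟨r, hr, hball⟩ := Metric.eventually_nhds_iff_ball.1 (hH c hσc).eventually_analyticAt
  have hdiff : DifferentiableOn ℂ H (Metric.ball (c : ℂ) r) := fun z hz =>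
    (hball z hz).differentiableAt.differentiableWithinAt
  -- the two functions agree on the real axis beyond `c`
  have hreal : EqOn (fun x : ℝ => complexMGF X μ x) (fun x : ℝ => H x) (Ioi c) := by
    have a1 : AnalyticOnNhd ℝ (fun x : ℝ => complexMGF X μ x) (Ioi c) := fun x hx =>
      ((analyticAt_complexMGF (z := (x : ℂ)) (hint' hx)).restrictScalars (𝕜 := ℝ)).comp
        (Complex.ofRealCLM.analyticAt x)
    have a2 : AnalyticOnNhd ℝ (fun x : ℝ => H x) (Ioi c) := fun x hx =>
      ((hH x (hσc.trans hx)).restrictScalars (𝕜 := ℝ)).comp (Complex.ofRealCLM.analyticAt x)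
    have hm : max c σ₁ + 1 ∈ Ioi c := (le_max_left c σ₁).trans_lt (lt_add_one _)
    refine a1.eqOn_of_preconnected_of_eventuallyEq a2 isPreconnected_Ioi hm ?_
    filter_upwards [Ioi_mem_nhds ((le_max_right c σ₁).trans_lt (lt_add_one _))] with x hx
    exact hHeq x hx
  -- The Taylor series of `H` at `p` converges on a disc of radius `3r/4`, which contains `q`, a
  -- point to the left of the abscissa `c`.
  set p : ℝ := c + r / 4 with hp
  set q : ℝ := c - r / 4 with hq
  have hpc : c < p := by rw [hp]; linarith
  have hev : complexMGF X μ =ᶠ[𝓝 (p : ℂ)] H := by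
    refine (AnalyticAt.frequently_eq_iff_eventually_eq
      (analyticAt_complexMGF (z := (p : ℂ)) (hint' hpc)) (hH p (hσc.trans hpc))).1 ?_
    have ht : Tendsto (fun x : ℝ => (x : ℂ)) (𝓝[≠] p) (𝓝[≠] (p : ℂ)) := by
      refine tendsto_nhdsWithin_of_tendsto_nhds_of_eventually_within _
        (Complex.continuous_ofReal.continuousAt.mono_left nhdsWithin_le_nhds) ?_
      filter_upwards [self_mem_nhdsWithin] with x hx
      exact fun h => hx (Complex.ofReal_injective h)
    refine ht.frequently (Eventually.frequently ?_)
    filter_upwards [nhdsWithin_le_nhds (Ioi_mem_nhds hpc)] with x hx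
    exact hreal hx
  have hsub : Metric.ball (p : ℂ) (3 * r / 4) ⊆ Metric.ball (c : ℂ) r := by
    refine Metric.ball_subset_ball' ?_
    rw [Complex.dist_eq, ← Complex.ofReal_sub, Complex.norm_real, Real.norm_eq_abs, hp,
      add_sub_cancel_left, abs_of_pos (by positivity)]
    linarith
  have hqp : q - p = -(r / 2) := by rw [hp, hq]; ring
  have hqmem : (q : ℂ) ∈ Metric.ball (p : ℂ) (3 * r / 4) := by
    rw [Metric.mem_ball, Complex.dist_eq, ← Complex.ofReal_sub, Complex.norm_real,
      Real.norm_eq_abs, hqp, abs_neg, abs_of_pos (by positivity)]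
    linarith
  have hsum := (Complex.hasSum_taylorSeries_on_ball (hdiff.mono hsub) hqmem).summable.norm
  have hpint := hint' hpc
  have hi (n : ℕ) : Integrable (fun ω => X ω ^ n * Real.exp (p * X ω)) μ :=
    integrable_pow_mul_exp_of_mem_interior_integrableExpSet hpint n
  have hcoef (n : ℕ) : iteratedDeriv n H p =
      ((∫ ω, X ω ^ n * Real.exp (p * X ω) ∂μ : ℝ) : ℂ) := by
    rw [← hev.iteratedDeriv_eq, iteratedDeriv_complexMGF (by simpa using hpint),
      ← integral_complex_ofReal]
    congr with ω
    push_cast; rfl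
  set g : ℕ → α → ℝ := fun n ω => ((q - p) * X ω) ^ n / n.factorial * Real.exp (p * X ω) with hg
  have hgi (n : ℕ) : Integrable (g n) μ := by
    refine ((hi n).const_mul ((q - p) ^ n / n.factorial)).congr (ae_of_all _ fun ω => ?_)
    simp only [hg]; rw [mul_pow]; ring
  -- Here the sign of `X` enters: `q < p` and `X ≤ 0` make all terms of the expansion of `exp (q X)`
  -- nonnegative. Tonelli then turns convergence of the Taylor series at `q` into integrability
  -- there, contradicting `q < c`.
  have hg0 (n : ℕ) : 0 ≤ᵐ[μ] g n := by
    filter_upwards [hX] with ω hω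
    have : 0 ≤ (q - p) * X ω := mul_nonneg_of_nonpos_of_nonpos (by rw [hqp]; linarith) hω
    simp only [hg, Pi.zero_apply]; positivity
  have hgint (n : ℕ) : ∫ ω, g n ω ∂μ =
      (q - p) ^ n / n.factorial * ∫ ω, X ω ^ n * Real.exp (p * X ω) ∂μ := by
    rw [← integral_const_mul]
    congr with ω
    simp only [hg]; rw [mul_pow]; ring
  have hgsum : Summable fun n => ∫ ω, g n ω ∂μ := by
    refine (hsum.congr fun n => ?_)
    rw [hcoef, ← abs_of_nonneg (integral_nonneg_of_ae (hg0 n)), hgint, smul_smul, norm_smul,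
      Complex.norm_real, ← Complex.ofReal_sub, abs_mul, abs_div, abs_pow, norm_mul, norm_pow,
      Complex.norm_real, norm_inv, Complex.norm_natCast, Nat.abs_cast]
    simp only [Real.norm_eq_abs]
    ring
  have hexp : ∀ ω, HasSum (fun n => g n ω) (Real.exp (q * X ω)) := fun ω => by
    have := (NormedSpace.expSeries_div_hasSum_exp ((q - p) * X ω)).mul_right (Real.exp (p * X ω))
    rw [← Real.exp_eq_exp_ℝ, ← Real.exp_add] at this
    rwa [show (q - p) * X ω + p * X ω = q * X ω by ring] at this
  have hqI : q ∈ I := by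
    refine ⟨(Real.measurable_exp.comp_aemeasurable (hXm.const_mul q)).aestronglyMeasurable, ?_⟩
    rw [hasFiniteIntegral_iff_ofReal (ae_of_all _ fun ω => (Real.exp_pos _).le)]
    have : ∀ᵐ ω ∂μ, ENNReal.ofReal (Real.exp (q * X ω)) = ∑' n, ENNReal.ofReal (g n ω) := by
      filter_upwards [ae_all_iff.2 hg0] with ω hω
      rw [← (hexp ω).tsum_eq, ENNReal.ofReal_tsum_of_nonneg hω (hexp ω).summable]
    rw [lintegral_congr_ae this, lintegral_tsum fun n => (hgi n).aemeasurable.ennreal_ofReal]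
    simp_rw [← fun n => ofReal_integral_eq_lintegral_ofReal (hgi n) (hg0 n)]
    rw [← ENNReal.ofReal_tsum_of_nonneg (fun n => integral_nonneg_of_ae (hg0 n)) hgsum]
    exact ENNReal.ofReal_lt_top
  have : c ≤ q := csInf_le hbdd hqI
  rw [hq] at this
  linarith

end

/-! ### A Tauberian theorem via Fourier smoothing -/

section

open MeasureTheory Set Filter Topology FourierTransform

lemma integrableOn_mul_cexp {f : ℝ → ℝ} (hfm : Measurable f) {C : ℝ} (hC : ∀ t, |f t| ≤ C)
    {z : ℂ} (hz : 0 < z.re) :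
    IntegrableOn (fun t => (f t : ℂ) * Complex.exp (-z * t)) (Ioi 0) := by
  have h1 : IntegrableOn (fun t => C * Real.exp (-z.re * t)) (Ioi 0) :=
    (exp_neg_integrableOn_Ioi 0 hz).const_mul C
  refine Integrable.mono' h1 (by fun_prop) (ae_of_all _ fun t => ?_)
  rw [norm_mul, Complex.norm_real, Complex.norm_exp]
  simp only [Complex.mul_re, Complex.neg_re, Complex.ofReal_re, Complex.neg_im, Complex.ofReal_im,
    mul_zero, sub_zero]
  exact mul_le_mul_of_nonneg_right (hC t) (Real.exp_pos _).le

/-- If the Laplace transform of a bounded function extends continuously to the imaginary axis, then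
its averages against the Fourier transform of a compactly supported function tend to zero. -/
lemma tendsto_integral_mul_fourier {f : ℝ → ℝ} (hfm : Measurable f) {C : ℝ} (hC : ∀ t, |f t| ≤ C)
    (hf0 : ∀ t < 0, f t = 0) {G : ℂ → ℂ} (hG : ContinuousOn G {z | 0 ≤ z.re})
    (hGeq : ∀ z : ℂ, 0 < z.re → ∫ t in Ioi (0 : ℝ), (f t : ℂ) * Complex.exp (-z * t) = G z)
    (k : SchwartzMap ℝ ℂ) (hk : HasCompactSupport k) :
    Tendsto (fun u : ℝ => ∫ x, (f (u + x) : ℂ) * 𝓕 (k : ℝ → ℂ) x) atTop (𝓝 0) := by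
  have hKint : Integrable (𝓕 (k : ℝ → ℂ)) := by
    rw [← SchwartzMap.fourier_coe]; exact (𝓕 k).integrable
  have hKcont : Continuous (𝓕 (k : ℝ → ℂ)) := by
    rw [← SchwartzMap.fourier_coe]; exact (𝓕 k).continuous
  set L : ℝ → ℂ := fun v => 2 * Real.pi * v * Complex.I with hL
  have hLcont : Continuous L := by fun_prop
  have hLre (v : ℝ) : (L v).re = 0 := by simp [hL]
  have hKx (x : ℝ) : 𝓕 (k : ℝ → ℂ) x = ∫ v, Complex.exp (-(L v) * x) * k v := by
    rw [Real.fourier_eq']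
    congr with v
    rw [smul_eq_mul]
    congr 2
    simp [hL]; ring
  -- The damping factor `exp (-ε t)` makes Fubini legitimate, and the inner integral is the Laplace
  -- transform at `ε + L v`.
  have hfub (u : ℝ) {ε : ℝ} (hε : 0 < ε) :
      ∫ t in Ioi (0 : ℝ), (f t : ℂ) * Complex.exp (-ε * t) * 𝓕 (k : ℝ → ℂ) (t - u) =
        ∫ v, Complex.exp (L v * u) * k v * G (ε + L v) := by
    have hint := (integrableOn_mul_cexp hfm hC (z := ε) (by simpa using hε)).mul_prod
      (k.integrable (μ := volume))
    have hint2 : Integrable (Function.uncurry fun (t v : ℝ) =>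
        (f t : ℂ) * Complex.exp (-ε * t) * k v * Complex.exp (-(L v) * (t - u)))
        ((volume.restrict (Ioi 0)).prod volume) := by
      refine (hint.bdd_mul (c := 1) (f := fun p : ℝ × ℝ =>
        Complex.exp (-(L p.2) * (p.1 - u))) ?_ (ae_of_all _ fun p => ?_)).congr
        (ae_of_all _ fun p => ?_)
      · exact Continuous.aestronglyMeasurable (by fun_prop)
      · rw [Complex.norm_exp]; simp [hL]
      · simp only [Function.uncurry]; ring
    calc _ = ∫ t in Ioi (0 : ℝ), ∫ v,
          (f t : ℂ) * Complex.exp (-ε * t) * k v * Complex.exp (-(L v) * (t - u)) := by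
            congr with t
            rw [hKx, ← integral_const_mul]
            congr with v
            push_cast; ring
      _ = ∫ v, ∫ t in Ioi (0 : ℝ),
          (f t : ℂ) * Complex.exp (-ε * t) * k v * Complex.exp (-(L v) * (t - u)) :=
            integral_integral_swap hint2
      _ = _ := by
            congr with v
            rw [← hGeq _ (by simp [hLre, hε]), ← integral_const_mul]
            congr with t
            rw [show -(L v) * ((t : ℂ) - u) = L v * u + -(L v) * t by ring,
              show -((ε : ℂ) + L v) * t = -ε * t + -(L v) * t by ring, Complex.exp_add,
              Complex.exp_add]
            ring
  have hlim (u : ℝ) : ∫ t in Ioi (0 : ℝ), (f t : ℂ) * 𝓕 (k : ℝ → ℂ) (t - u) =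
      ∫ v, Complex.exp (L v * u) * k v * G (L v) := by
    have hc : Tendsto (fun ε : ℝ => (ε : ℂ)) (𝓝[>] 0) (𝓝 0) :=
      (Complex.continuous_ofReal.tendsto' 0 0 (by simp)).mono_left nhdsWithin_le_nhds
    have h1 : Tendsto (fun ε : ℝ => ∫ t in Ioi (0 : ℝ),
        (f t : ℂ) * Complex.exp (-ε * t) * 𝓕 (k : ℝ → ℂ) (t - u)) (𝓝[>] 0)
        (𝓝 (∫ t in Ioi (0 : ℝ), (f t : ℂ) * 𝓕 (k : ℝ → ℂ) (t - u))) := by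
      refine tendsto_integral_filter_of_dominated_convergence
        (fun t => C * ‖𝓕 (k : ℝ → ℂ) (t - u)‖) ?_ ?_ ?_ ?_
      · exact Eventually.of_forall fun ε => by fun_prop
      · filter_upwards [self_mem_nhdsWithin] with ε hε
        filter_upwards [ae_restrict_mem measurableSet_Ioi] with t ht
        rw [norm_mul, norm_mul, Complex.norm_real, Complex.norm_exp]
        refine mul_le_mul_of_nonneg_right ?_ (norm_nonneg _)
        refine (mul_le_of_le_one_right (norm_nonneg _) ?_).trans (hC t)
        have : 0 < ε * t := mul_pos hε ht
        simpa using this.le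
      · exact ((hKint.comp_sub_right u).norm.const_mul C).integrableOn
      · refine ae_of_all _ fun t => ?_
        have : Tendsto (fun ε : ℝ => Complex.exp (-ε * t)) (𝓝[>] 0) (𝓝 1) := by
          have := ((hc.neg).mul_const (t : ℂ)).cexp
          simpa using this
        simpa using (this.const_mul (f t : ℂ)).mul_const (𝓕 (k : ℝ → ℂ) (t - u))
    have h2 : Tendsto (fun ε : ℝ => ∫ v, Complex.exp (L v * u) * k v * G (ε + L v)) (𝓝[>] 0)
        (𝓝 (∫ v, Complex.exp (L v * u) * k v * G (L v))) := by
      -- Compact support of `k` confines `G` to a compact piece of the closed half-plane, which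
      -- supplies the dominating function as `ε → 0`.
      obtain ⟨B, hB⟩ := ((isCompact_Icc (a := (0 : ℝ)) (b := 1)).prod hk).exists_bound_of_continuousOn
        (f := fun p : ℝ × ℝ => G (p.1 + L p.2)) (by
          refine hG.comp (by fun_prop) fun p hp => ?_
          simpa [hLre] using hp.1.1)
      have hGc (ε : ℝ) (hε : 0 ≤ ε) : Continuous fun v : ℝ => G (ε + L v) :=
        hG.comp_continuous (by fun_prop) fun v => by simpa [hLre] using hε
      refine tendsto_integral_filter_of_dominated_convergence (fun v => ‖k v‖ * B) ?_ ?_ ?_ ?_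
      · filter_upwards [self_mem_nhdsWithin] with ε hε
        exact (((show Continuous fun v => Complex.exp (L v * u) by fun_prop).mul
          k.continuous).mul (hGc ε (le_of_lt hε))).aestronglyMeasurable
      · filter_upwards [self_mem_nhdsWithin, nhdsWithin_le_nhds (Iic_mem_nhds one_pos)] with ε hε hε1
        refine ae_of_all _ fun v => ?_
        rw [norm_mul, norm_mul, Complex.norm_exp]
        have : (L v * u).re = 0 := by simp [hL]
        rw [this, Real.exp_zero, one_mul]
        by_cases hv : v ∈ tsupport k
        · exact mul_le_mul_of_nonneg_left (hB (ε, v) ⟨⟨le_of_lt hε, hε1⟩, hv⟩) (norm_nonneg _)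
        · simp [image_eq_zero_of_notMem_tsupport hv]
      · exact k.integrable.norm.mul_const B
      · refine ae_of_all _ fun v => ?_
        refine Tendsto.const_mul _ ?_
        have hcw : ContinuousWithinAt G {z | 0 ≤ z.re} (L v) := hG _ (by simp [hLre])
        refine hcw.tendsto.comp (tendsto_nhdsWithin_iff.2 ⟨by simpa using hc.add_const (L v), ?_⟩)
        filter_upwards [self_mem_nhdsWithin] with ε hε
        simpa [hLre] using le_of_lt hε
    refine tendsto_nhds_unique h1 (h2.congr' ?_)
    filter_upwards [self_mem_nhdsWithin] with ε hε
    exact (hfub u hε).symm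
  -- Riemann–Lebesgue for the right-hand side of `hlim`.
  have hRL := (Real.tendsto_integral_exp_smul_cocompact fun v => k v * G (L v)).comp
    (tendsto_neg_atTop_atBot.mono_right atBot_le_cocompact)
  refine hRL.congr fun u => ?_
  calc _ = ∫ v, Complex.exp (L v * u) * k v * G (L v) := by
        simp only [Function.comp]
        congr with v
        rw [Circle.smul_def, Real.fourierChar_apply, smul_eq_mul, ← mul_assoc]
        congr 3
        simp only [hL]
        push_cast
        ring
    _ = ∫ t in Ioi (0 : ℝ), (f t : ℂ) * 𝓕 (k : ℝ → ℂ) (t - u) := (hlim u).symm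
    _ = ∫ t in Ici (0 : ℝ), (f t : ℂ) * 𝓕 (k : ℝ → ℂ) (t - u) := integral_Ici_eq_integral_Ioi.symm
    _ = ∫ t, (f t : ℂ) * 𝓕 (k : ℝ → ℂ) (t - u) := by
        refine setIntegral_eq_integral_of_forall_compl_eq_zero fun t ht => ?_
        rw [hf0 t (by simpa using ht)]; simp
    _ = _ := by
        rw [← integral_add_left_eq_self _ u]
        simp

lemma exists_schwartzMap_hasCompactSupport :
    ∃ k : SchwartzMap ℝ ℂ, HasCompactSupport k ∧ k 0 = 1 := by
  obtain ⟨b⟩ : Nonempty (ContDiffBump (0 : ℝ)) := inferInstance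
  have h1 : HasCompactSupport (Complex.ofReal ∘ (b : ℝ → ℝ)) :=
    HasCompactSupport.comp_left b.hasCompactSupport Complex.ofReal_zero
  have h2 : ContDiff ℝ ((⊤ : ℕ∞) : WithTop ℕ∞) (Complex.ofReal ∘ (b : ℝ → ℝ)) :=
    Complex.ofRealCLM.contDiff.comp b.contDiff
  have h3 : (b 0 : ℂ) = 1 := by
    rw [b.one_of_mem_closedBall (Metric.mem_closedBall_self b.rIn_pos.le), Complex.ofReal_one]
  exact ⟨h1.toSchwartzMap h2, h1, h3⟩

/-- A Tauberian theorem: a bounded slowly oscillating function whose Laplace transform extends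
continuously to the imaginary axis tends to zero. -/
theorem tendsto_zero_of_laplace_continuousOn {f : ℝ → ℝ} (hfm : Measurable f) {C : ℝ}
    (hC : ∀ t, |f t| ≤ C) (hf0 : ∀ t < 0, f t = 0)
    (hosc : ∀ s t, s ≤ t → |f t - f s| ≤ (t - s) + Real.exp (-s))
    {G : ℂ → ℂ} (hG : ContinuousOn G {z | 0 ≤ z.re})
    (hGeq : ∀ z : ℂ, 0 < z.re → ∫ t in Ioi (0 : ℝ), (f t : ℂ) * Complex.exp (-z * t) = G z) :
    Tendsto f atTop (𝓝 0) := by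
  obtain ⟨k, hk, hk0⟩ := exists_schwartzMap_hasCompactSupport
  set K : ℝ → ℂ := 𝓕 (k : ℝ → ℂ) with hK
  have hKint : Integrable K := by
    rw [hK, ← SchwartzMap.fourier_coe]; exact (𝓕 k).integrable
  have hKint1 : Integrable fun x => |x| * ‖K x‖ := by
    rw [hK, ← SchwartzMap.fourier_coe]
    refine ((𝓕 k).integrable_pow_mul volume 1).congr (ae_of_all _ fun x => ?_)
    simp
  have hKtot : ∫ x, K x = 1 := by
    have h1 : 𝓕⁻ (𝓕 k) = k := FourierTransform.fourierInv_fourier_eq k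
    have h2 : (𝓕⁻ (𝓕 k)) 0 = 1 := by rw [h1, hk0]
    rw [SchwartzMap.fourierInv_coe, Real.fourierInv_eq'] at h2
    rw [← h2]
    simp [hK, SchwartzMap.fourier_coe]
  set M := ∫ x, |x| * ‖K x‖ with hM
  have hM0 : 0 ≤ M := integral_nonneg fun x => by positivity
  rw [Metric.tendsto_atTop']
  intro ε hε
  -- Stretching `f` to `t ↦ f (t / l)` reduces its rate of oscillation to `1 / l`, so averaging
  -- against the fixed kernel `K` of mass one costs only `M / l` besides an error that vanishes as
  -- `u → ∞`.
  obtain ⟨l, hl0, hlM⟩ : ∃ l : ℝ, 0 < l ∧ l⁻¹ * M < ε / 2 := by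
    refine ⟨2 * (M + 1) / ε, by positivity, ?_⟩
    rw [inv_div, div_mul_eq_mul_div, div_lt_div_iff₀ (by positivity) two_pos]
    nlinarith
  have hsm := tendsto_integral_mul_fourier (f := fun t => f (t / l)) (C := C)
    (hfm.comp (measurable_id.div_const l)) (fun t => hC _)
    (fun t ht => hf0 _ (div_neg_of_neg_of_pos ht hl0)) (G := fun z => l * G (l * z))
    (by
      refine continuousOn_const.mul (hG.comp (by fun_prop) fun z hz => ?_)
      simpa using mul_nonneg hl0.le hz)
    (fun z hz => by
      rw [← hGeq (l * z) (by simpa using mul_pos hl0 hz)]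
      have := integral_comp_mul_left_Ioi
        (fun t : ℝ => (f (t / l) : ℂ) * Complex.exp (-z * t)) 0 hl0
      rw [mul_zero, eq_inv_smul_iff₀ hl0.ne'] at this
      rw [← this, Complex.real_smul]
      congr 1
      refine setIntegral_congr_fun measurableSet_Ioi fun t _ => ?_
      simp only [mul_div_cancel_left₀ _ hl0.ne']
      push_cast
      congr 2; ring) k hk
  -- The exponential error blows up for very negative `x`; the trivial bound `2 * C` caps it and
  -- permits dominated convergence.
  set e : ℝ → ℝ → ℝ := fun u x => min (2 * C) (Real.exp (-(min u (u + x) / l))) with he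
  have hC0 : 0 ≤ C := (abs_nonneg _).trans (hC 0)
  have he0 (u x : ℝ) : 0 ≤ e u x := le_min (by positivity) (Real.exp_pos _).le
  have heb (u x : ℝ) : ‖e u x * ‖K x‖‖ ≤ 2 * C * ‖K x‖ := by
    rw [norm_mul, norm_norm, Real.norm_of_nonneg (he0 u x)]
    exact mul_le_mul_of_nonneg_right (min_le_left _ _) (norm_nonneg _)
  have hem (u : ℝ) : AEStronglyMeasurable (fun x => e u x * ‖K x‖) := by
    refine AEStronglyMeasurable.mul (Continuous.aestronglyMeasurable ?_)
      hKint.aestronglyMeasurable.norm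
    simp only [he]; fun_prop
  have heint (u : ℝ) : Integrable fun x => e u x * ‖K x‖ :=
    (hKint.norm.const_mul (2 * C)).mono' (hem u) (ae_of_all _ (heb u))
  have herr : Tendsto (fun u => ∫ x, e u x * ‖K x‖) atTop (𝓝 0) := by
    have : Tendsto (fun u => ∫ x, e u x * ‖K x‖) atTop (𝓝 (∫ _ : ℝ, (0 : ℝ))) := by
      refine tendsto_integral_filter_of_dominated_convergence (fun x => 2 * C * ‖K x‖)
        (Eventually.of_forall hem) (Eventually.of_forall fun u => ae_of_all _ (heb u))
        (hKint.norm.const_mul _) (ae_of_all _ fun x => ?_)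
      have h1 : Tendsto (fun u : ℝ => min u (u + x)) atTop atTop :=
        tendsto_atTop.2 fun b => (eventually_ge_atTop (max b (b - x))).mono fun u hu =>
          le_min (by linarith [le_max_left b (b - x)]) (by linarith [le_max_right b (b - x)])
      have h2 : Tendsto (fun u : ℝ => Real.exp (-(min u (u + x) / l))) atTop (𝓝 0) :=
        Real.tendsto_exp_neg_atTop_nhds_zero.comp (h1.atTop_div_const hl0)
      have h3 := (squeeze_zero (he0 · x) (fun u => min_le_right _ _) h2).mul_const ‖K x‖
      simpa using h3
    simpa using this
  have hosc' (u x : ℝ) : |f (u / l) - f ((u + x) / l)| ≤ l⁻¹ * |x| + e u x := by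
    have h2 : |f (u / l) - f ((u + x) / l)| ≤ 2 * C :=
      (abs_sub _ _).trans (by linarith [hC (u / l), hC ((u + x) / l)])
    have h1 : |f (u / l) - f ((u + x) / l)| ≤ l⁻¹ * |x| + Real.exp (-(min u (u + x) / l)) := by
      rcases le_total 0 x with hx | hx
      · rw [min_eq_left (by linarith), abs_sub_comm, abs_of_nonneg hx]
        refine (hosc (u / l) ((u + x) / l) (by gcongr; linarith)).trans (le_of_eq ?_)
        field_simp; ring
      · rw [min_eq_right (by linarith), abs_of_nonpos hx]
        refine (hosc ((u + x) / l) (u / l) (by gcongr; linarith)).trans (le_of_eq ?_)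
        field_simp; ring
    rw [he, ← min_add_add_left]
    exact le_min (h2.trans (le_add_of_nonneg_left (by positivity))) h1
  have hmain (u : ℝ) : |f (u / l)| ≤
      ‖∫ x, (f ((u + x) / l) : ℂ) * K x‖ + (l⁻¹ * M + ∫ x, e u x * ‖K x‖) := by
    have i1 : Integrable fun x => (f ((u + x) / l) : ℂ) * K x :=
      hKint.bdd_mul (c := C) (Complex.measurable_ofReal.comp
        (hfm.comp ((measurable_const_add u).div_const l))).aestronglyMeasurable (ae_of_all _ fun x => by
        rw [Complex.norm_real]; exact hC _)
    have e1 : (f (u / l) : ℂ) = (∫ x, (f ((u + x) / l) : ℂ) * K x) +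
        ∫ x, ((f (u / l) - f ((u + x) / l) : ℝ) : ℂ) * K x := by
      rw [← integral_add i1]
      · rw [← mul_one (f (u / l) : ℂ), ← hKtot, ← integral_const_mul]
        congr with x
        push_cast; ring
      · refine ((hKint.const_mul (f (u / l) : ℂ)).sub i1).congr (ae_of_all _ fun x => ?_)
        simp only [Pi.sub_apply]; push_cast; ring
    have e2 : ‖∫ x, ((f (u / l) - f ((u + x) / l) : ℝ) : ℂ) * K x‖ ≤
        l⁻¹ * M + ∫ x, e u x * ‖K x‖ := by
      rw [hM, ← integral_const_mul, ← integral_add (hKint1.const_mul _) (heint u)]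
      refine norm_integral_le_of_norm_le ((hKint1.const_mul _).add (heint u))
        (ae_of_all _ fun x => ?_)
      rw [norm_mul, Complex.norm_real, Real.norm_eq_abs]
      refine (mul_le_mul_of_nonneg_right (hosc' u x) (norm_nonneg _)).trans (le_of_eq ?_)
      ring
    calc |f (u / l)| = ‖(f (u / l) : ℂ)‖ := by rw [Complex.norm_real, Real.norm_eq_abs]
      _ ≤ _ := by rw [e1]; exact (norm_add_le _ _).trans (by gcongr)
  have hev : ∀ᶠ u in atTop, |f (u / l)| < ε := by
    have := (hsm.norm.add herr)
    rw [norm_zero, add_zero] at this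
    filter_upwards [this.eventually (gt_mem_nhds (half_pos hε))] with u hu
    have := hmain u
    simp only [← hK] at hu
    linarith
  obtain ⟨N, hN⟩ := (eventually_atTop.1 ((tendsto_id.const_mul_atTop hl0).eventually hev))
  refine ⟨N, fun t ht => ?_⟩
  have := hN t ht.le
  simp only [id, mul_div_cancel_left₀ _ hl0.ne'] at this
  simpa [Real.dist_eq] using this

end

/-! ### Half-planes of convergence, zeros of zeta, and reduction of the Riemann Hypothesis -/

section

open MeasureTheory Set Filter Topology ProbabilityTheory

/-- The measure on `(0, ∞)` with density `B`; its moment generating function in the variable `-u`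
is the Laplace transform of `B`. -/
noncomputable def laplaceMeasure (B : ℝ → ℝ) : Measure ℝ :=
  (volume.restrict (Ioi 0)).withDensity fun u => ENNReal.ofReal (B u)

lemma complexMGF_laplaceMeasure {B : ℝ → ℝ} (hBm : Measurable B) (hB0 : ∀ u, 0 ≤ B u) (z : ℂ) :
    complexMGF (fun u => -u) (laplaceMeasure B) z =
      ∫ u in Ioi (0 : ℝ), (B u : ℂ) * Complex.exp (-z * u) := by
  rw [complexMGF, laplaceMeasure, integral_withDensity_eq_integral_toReal_smul
    hBm.ennreal_ofReal (ae_of_all _ fun _ => ENNReal.ofReal_lt_top)]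
  congr with u
  rw [ENNReal.toReal_ofReal (hB0 u), Complex.real_smul]
  push_cast
  ring_nf

lemma mem_integrableExpSet_laplaceMeasure {B : ℝ → ℝ} (hBm : Measurable B) (hB0 : ∀ u, 0 ≤ B u)
    {C a : ℝ} (hBC : ∀ u, 0 < u → B u ≤ C * Real.exp (a * u)) {σ : ℝ} (hσ : a < σ) :
    σ ∈ integrableExpSet (fun u => -u) (laplaceMeasure B) := by
  change Integrable _ _
  rw [laplaceMeasure, integrable_withDensity_iff_integrable_smul' hBm.ennreal_ofReal
    (ae_of_all _ fun _ => ENNReal.ofReal_lt_top)]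
  have h1 : IntegrableOn (fun u => C * Real.exp (-(σ - a) * u)) (Ioi 0) :=
    (exp_neg_integrableOn_Ioi 0 (sub_pos.2 hσ)).const_mul C
  refine Integrable.mono' h1 (by fun_prop) ?_
  filter_upwards [ae_restrict_mem measurableSet_Ioi] with u hu
  rw [ENNReal.toReal_ofReal (hB0 u), smul_eq_mul, norm_mul, Real.norm_of_nonneg (hB0 u),
    Real.norm_of_nonneg (Real.exp_pos _).le]
  refine (mul_le_mul_of_nonneg_right (hBC u hu) (Real.exp_pos _).le).trans (le_of_eq ?_)
  rw [mul_assoc, ← Real.exp_add]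
  congr 2; ring

lemma ae_laplaceMeasure_nonpos (B : ℝ → ℝ) : ∀ᵐ u ∂(laplaceMeasure B), -u ≤ 0 := by
  refine (withDensity_absolutelyContinuous _ _).ae_le ?_
  filter_upwards [ae_restrict_mem measurableSet_Ioi] with u hu
  exact neg_nonpos.2 (le_of_lt hu)

/-- Absolute convergence depends only on the real part, so Landau's conclusion on the real axis
yields holomorphy on a half-plane. -/
lemma differentiableOn_complexMGF_of_forall_mem {B : ℝ → ℝ} {a : ℝ}
    (h : ∀ σ, a < σ → σ ∈ integrableExpSet (fun u => -u) (laplaceMeasure B)) :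
    DifferentiableOn ℂ (complexMGF (fun u => -u) (laplaceMeasure B)) {z | a < z.re} :=
  differentiableOn_complexMGF.mono fun _ hz => interior_maximal (s := integrableExpSet _ _)
    (t := Ioi a) (fun σ hσ => h σ hσ) isOpen_Ioi hz

lemma isOpen_halfPlane (a : ℝ) : IsOpen {z : ℂ | a < z.re} :=
  isOpen_lt continuous_const Complex.continuous_re

lemma eqOn_halfPlane {f g : ℂ → ℂ} {a b : ℝ} (hf : DifferentiableOn ℂ f {z | a < z.re})
    (hg : DifferentiableOn ℂ g {z | a < z.re}) (h : EqOn f g {z | b < z.re}) :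
    EqOn f g {z | a < z.re} := by
  have hm : ((max a b + 1 : ℝ) : ℂ) ∈ {z : ℂ | a < z.re} := by
    simpa using (le_max_left a b).trans_lt (lt_add_one _)
  refine (hf.analyticOnNhd (isOpen_halfPlane a)).eqOn_of_preconnected_of_eventuallyEq
    (hg.analyticOnNhd (isOpen_halfPlane a)) (convex_halfSpace_re_gt a).isPreconnected hm ?_
  refine Filter.mem_of_superset ((isOpen_halfPlane b).mem_nhds ?_) h
  simpa using (le_max_right a b).trans_lt (lt_add_one _)

lemma integral_Ioi_cexp_neg {z : ℂ} (hz : 0 < z.re) :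
    ∫ u in Ioi (0 : ℝ), Complex.exp (-z * u) = z⁻¹ := by
  rw [integral_exp_mul_complex_Ioi (by simpa using hz)]
  simp [neg_div]

lemma integrableOn_cexp_neg {z : ℂ} (hz : 0 < z.re) :
    IntegrableOn (fun u : ℝ => Complex.exp (-z * u)) (Ioi 0) := by
  simpa using integrableOn_mul_cexp (f := fun _ => 1) measurable_const (C := 1) (by simp) hz

/-- For `Re s > 1`, write `⌊x⌋ = x - {x}` in `ζ(s) = s ∫ ⌊x⌋ x^(-s-1) dx`; the identity theorem
extends the result to `Re s > 0`. On `(0, 1)` it displays `(s - 1) ζ(s)` as a positive number. -/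
lemma riemannZeta₁_eq_laplace {s : ℂ} (hs : 0 < s.re) :
    riemannZeta₁ s = s - s * (s - 1) *
      complexMGF (fun u => -u) (laplaceMeasure fun u => Int.fract (Real.exp u)) s := by
  have hm : Measurable fun u => Int.fract (Real.exp u) := by fun_prop
  have h0 : ∀ u, 0 ≤ Int.fract (Real.exp u) := fun u => Int.fract_nonneg _
  have hmem : ∀ σ, 0 < σ → σ ∈ integrableExpSet (fun u => -u)
      (laplaceMeasure fun u => Int.fract (Real.exp u)) := fun σ hσ =>
    mem_integrableExpSet_laplaceMeasure hm h0 (C := 1) (a := 0)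
      (fun u _ => by simpa using (Int.fract_lt_one _).le) hσ
  have hd := differentiableOn_complexMGF_of_forall_mem hmem
  refine eqOn_halfPlane (a := 0) (b := 1) (g := fun s => s - s * (s - 1) *
    complexMGF (fun u => -u) (laplaceMeasure fun u => Int.fract (Real.exp u)) s)
    differentiable_riemannZeta₁.differentiableOn (by fun_prop) ?_ hs
  intro z (hz : 1 < z.re)
  have hz1 : z ≠ 1 := by rintro rfl; simp at hz
  have hzeta : riemannZeta z = z * ∫ u in Ioi (0 : ℝ),
      ((∑ k ∈ Finset.Icc 1 ⌊Real.exp u⌋₊, (1 : ℝ) : ℝ) : ℂ) * Complex.exp (-z * u) := by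
    rw [← LSeries_eq_mul_laplace (f := fun _ => 1) zero_le_one hz]
    · rw [← LSeries_one_eq_riemannZeta hz]; simp; rfl
    · simp only [Complex.ofReal_one]
      exact LSeriesSummable_one_iff.2 hz
    · simpa using Asymptotics.isBigO_refl _ _
  have hsplit : ∀ u : ℝ, ((∑ k ∈ Finset.Icc 1 ⌊Real.exp u⌋₊, (1 : ℝ) : ℝ) : ℂ) *
      Complex.exp (-z * u) = Complex.exp (-(z - 1) * u) -
        ((Int.fract (Real.exp u) : ℝ) : ℂ) * Complex.exp (-z * u) := fun u => by
    have : (∑ k ∈ Finset.Icc 1 ⌊Real.exp u⌋₊, (1 : ℝ)) = Real.exp u - Int.fract (Real.exp u) := by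
      have h := natCast_floor_eq_intCast_floor (R := ℝ) (Real.exp_pos u).le
      rw [Finset.sum_const, Nat.card_Icc, nsmul_eq_mul, mul_one, Nat.add_sub_cancel, h,
        Int.self_sub_fract]
    rw [this, show -(z - 1) * (u : ℂ) = u + -z * u by ring, Complex.exp_add]
    push_cast; ring
  have hi1 := integrableOn_cexp_neg (z := z - 1) (by simpa using hz)
  have hi2 := integrableOn_mul_cexp hm (C := 1) (fun u => by
    rw [abs_of_nonneg (h0 u)]; exact (Int.fract_lt_one _).le) (z := z) (by linarith)
  simp only
  rw [riemannZeta₁_eq hz1, hzeta, complexMGF_laplaceMeasure hm h0]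
  simp_rw [hsplit]
  rw [integral_sub hi1 hi2, integral_Ioi_cexp_neg (by simpa using hz)]
  have := sub_ne_zero.2 hz1
  field_simp

lemma riemannZeta₁_ne_zero_of_one_le_re {s : ℂ} (hs : 1 ≤ s.re) : riemannZeta₁ s ≠ 0 := by
  rcases eq_or_ne s 1 with rfl | h
  · simp
  · rw [riemannZeta₁_eq h]
    exact mul_ne_zero (sub_ne_zero.2 h) (riemannZeta_ne_zero_of_one_le_re hs)

/-- The zeta function has no zeros on the positive real axis. -/
lemma riemannZeta₁_ofReal_ne_zero {σ : ℝ} (hσ : 0 < σ) : riemannZeta₁ σ ≠ 0 := by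
  rcases le_or_gt 1 σ with h | h
  · exact riemannZeta₁_ne_zero_of_one_le_re (by simpa using h)
  · rw [riemannZeta₁_eq_laplace (by simpa using hσ), complexMGF_ofReal]
    set m := mgf (fun u => -u) (laplaceMeasure fun u => Int.fract (Real.exp u)) σ
    have hm : 0 ≤ m := mgf_nonneg
    have : (0 : ℝ) < σ - σ * (σ - 1) * m := by
      have : 0 ≤ σ * (1 - σ) * m := mul_nonneg (mul_nonneg hσ.le (by linarith)) hm
      linarith
    exact_mod_cast this.ne'

lemma differentiableOn_riemannZeta_two_mul :
    DifferentiableOn ℂ (fun s => riemannZeta (2 * s)) {z | 1 / 2 < z.re} := by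
  intro s hs
  have h : 2 * s ≠ 1 := by
    intro h
    have h2 := congrArg Complex.re h
    simp only [Complex.mul_re, Complex.re_ofNat, Complex.im_ofNat, Complex.one_re] at h2
    have : 1 / 2 < s.re := hs
    linarith
  exact ((differentiableAt_riemannZeta h).comp s (by fun_prop)).differentiableWithinAt

lemma differentiable_two_cpow : Differentiable ℂ fun s : ℂ => (2 : ℂ) ^ (1 - s) := fun s =>
  DifferentiableAt.const_cpow (by fun_prop) (Or.inl two_ne_zero)

/-- If `ζ` has no zeros to the right of the critical line, the Riemann Hypothesis holds. -/
lemma riemannHypothesis_of_forall_ne_zero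
    (h : ∀ s : ℂ, 1 / 2 < s.re → s ≠ 1 → riemannZeta s ≠ 0) : RiemannHypothesis := by
  intro s hs htriv hs1
  have hs0 : s ≠ 0 := by rintro rfl; simp [riemannZeta_zero] at hs
  rcases lt_trichotomy s.re (1 / 2) with hlt | heq | hgt
  · exfalso
    -- `Gammaℝ` takes the value `0` exactly at its poles `0, -2, -4, …`, all excluded here.
    have hΓ : Complex.Gammaℝ s ≠ 0 := by
      rw [Ne, Complex.Gammaℝ_eq_zero_iff]
      rintro ⟨n, hn⟩
      rcases n with _ | n
      · simp at hn; exact hs0 hn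
      · exact htriv ⟨n, by rw [hn]; push_cast; ring⟩
    have hΛ : completedRiemannZeta s = 0 := by
      rw [riemannZeta_def_of_ne_zero hs0, div_eq_zero_iff] at hs
      exact hs.resolve_right hΓ
    have h1s : 1 - s ≠ 0 := sub_ne_zero.2 (Ne.symm hs1)
    refine h (1 - s) ?_ (by simpa using hs0) ?_
    · rw [Complex.sub_re, Complex.one_re]; linarith
    · rw [riemannZeta_def_of_ne_zero h1s, completedRiemannZeta_one_sub, hΛ, zero_div]
  · exact heq
  · exact absurd hs (h s hgt hs1)

/-- If `(1 + 2 ^ (1 - s)) ζ(2 s) / ζ(s)` continues holomorphically to the right of the critical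
line, the Riemann Hypothesis holds. -/
lemma riemannHypothesis_of_continuation {K : ℂ → ℂ} (hK : DifferentiableOn ℂ K {z | 1 / 2 < z.re})
    (hKeq : ∀ s : ℂ, 1 < s.re → riemannZeta₁ s * K s =
      (s - 1) * (1 + (2 : ℂ) ^ (1 - s)) * riemannZeta (2 * s)) : RiemannHypothesis := by
  refine riemannHypothesis_of_forall_ne_zero fun s hs hs1 hzero => ?_
  have hre : s.re < 1 := by
    by_contra! hge
    exact riemannZeta_ne_zero_of_one_le_re hge hzero
  have hd : Differentiable ℂ fun s : ℂ => (s - 1) * (1 + (2 : ℂ) ^ (1 - s)) :=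
    (differentiable_id.sub_const 1).mul (differentiable_two_cpow.const_add 1)
  have heq := eqOn_halfPlane (a := 1 / 2) (b := 1)
    (differentiable_riemannZeta₁.differentiableOn.mul hK)
    (hd.differentiableOn.mul differentiableOn_riemannZeta_two_mul) (fun z hz => hKeq z hz) hs
  simp only [Pi.mul_apply, riemannZeta₁_eq hs1, hzero, mul_zero, zero_mul] at heq
  have h2 : riemannZeta (2 * s) ≠ 0 := riemannZeta_ne_zero_of_one_le_re (by
    simp only [Complex.mul_re, Complex.re_ofNat, Complex.im_ofNat]; linarith)
  -- For `Re s < 1` the modulus `2^(1 - Re s)` exceeds `1`, so the power cannot be `-1`.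
  have h3 : 1 + (2 : ℂ) ^ (1 - s) ≠ 0 := by
    intro h
    have h4 : ‖(2 : ℂ) ^ (1 - s)‖ = 1 := by
      rw [eq_neg_of_add_eq_zero_right h]; simp
    have h5 := Complex.norm_natCast_cpow_of_pos two_pos (1 - s)
    push_cast at h5
    rw [h4, Complex.sub_re, Complex.one_re] at h5
    have := Real.one_lt_rpow (x := 2) one_lt_two (sub_pos.2 hre)
    linarith
  exact mul_ne_zero (mul_ne_zero (sub_ne_zero.2 hs1) h3) h2 heq.symm

end

/-! ### The limits of `S` and `T`, and the two sign criteria -/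

section

open MeasureTheory Set Filter Topology ProbabilityTheory

lemma sumT_natCast (N : ℕ) : sumT N = ∑ n ∈ Finset.Icc 1 N, paritySign n / n := by
  rw [sumT, Nat.floor_natCast]

lemma measurable_sumS : Measurable sumS := measurable_sum_floor _

lemma measurable_sumT : Measurable sumT := measurable_sum_floor fun n => paritySign n / n

lemma abs_sumT_le (x : ℝ) : |sumT x| ≤ 4 := abs_sum_paritySign_div_le _

lemma abs_sum_paritySign_le (N : ℕ) : |∑ n ∈ Finset.Icc 1 N, paritySign n| ≤ N := by
  refine (Finset.abs_sum_le_sum_abs _ _).trans ?_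
  simp [abs_paritySign]

lemma abs_sumS_le (x : ℝ) : |sumS x| ≤ ⌊x⌋₊ := abs_sum_paritySign_le _

lemma term_paritySign_div {z : ℂ} (n : ℕ) :
    LSeries.term (fun n => ((paritySign n / n : ℝ) : ℂ)) z n =
      LSeries.term (fun n => (paritySign n : ℂ)) (z + 1) n := by
  rcases eq_or_ne n 0 with rfl | hn
  · simp
  have hn' : (n : ℂ) ≠ 0 := by exact_mod_cast hn
  rw [LSeries.term_of_ne_zero hn, LSeries.term_of_ne_zero hn, Complex.cpow_add _ _ hn',
    Complex.cpow_one]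
  push_cast
  rw [div_div, mul_comm]

lemma laplace_sumS {z : ℂ} (hz : 1 < z.re) :
    z * ∫ u in Ioi (0 : ℝ), (sumS (Real.exp u) : ℂ) * Complex.exp (-z * u) =
      LSeries (fun n => (paritySign n : ℂ)) z := by
  refine (LSeries_eq_mul_laplace zero_le_one hz (LSeriesSummable_paritySign hz) ?_).symm
  refine Asymptotics.isBigO_of_le _ fun n => ?_
  simpa using abs_sum_paritySign_le n

/-- The Laplace transform of `u ↦ T(exp u)`. -/
lemma laplace_sumT {z : ℂ} (hz : 0 < z.re) :
    riemannZeta₁ (z + 1) * ∫ u in Ioi (0 : ℝ), (sumT (Real.exp u) : ℂ) * Complex.exp (-z * u) =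
      -((1 + (2 : ℂ) ^ (-z)) * riemannZeta (2 * (z + 1))) := by
  have hz0 : z ≠ 0 := by rintro rfl; simp at hz
  have hz1 : 1 < (z + 1).re := by simpa using hz
  have h1 : LSeriesSummable (fun n => ((paritySign n / n : ℝ) : ℂ)) z :=
    (LSeriesSummable_paritySign hz1).congr fun n => (term_paritySign_div n).symm
  have h2 : LSeries (fun n => ((paritySign n / n : ℝ) : ℂ)) z =
      LSeries (fun n => (paritySign n : ℂ)) (z + 1) := tsum_congr term_paritySign_div
  have h3 := LSeries_eq_mul_laplace le_rfl hz h1 (by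
    simp only [Real.rpow_zero]
    exact Asymptotics.isBigO_of_le' (c := 4) _ fun n => by
      simpa using abs_sum_paritySign_div_le n)
  have h4 := riemannZeta₁_mul_LSeries_paritySign hz1
  rw [← h2, h3, show (1 : ℂ) - (z + 1) = -z by ring, add_sub_cancel_right] at h4
  refine mul_left_cancel₀ hz0 ?_
  simp only [sumT]
  linear_combination h4

/-- Later terms satisfy `1/(n+1) ≤ log (n+1) - log n`; the first is bounded separately by `x⁻¹`, the
source of `exp (-s)` in the oscillation bound. -/
lemma sum_Ioc_inv_le {x : ℝ} (hx : 0 < x) {N : ℕ} (hN : x < N + 1) {M : ℕ} (hM : N + 1 ≤ M) :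
    ∑ n ∈ Finset.Ioc N M, (n : ℝ)⁻¹ ≤ Real.log M - Real.log x + x⁻¹ := by
  induction M, hM using Nat.le_induction with
  | base =>
    rw [Finset.sum_Ioc_succ_top le_rfl]
    have h1 := Real.log_le_log hx hN.le
    have h2 := inv_anti₀ hx hN.le
    push_cast
    simp only [Finset.Ioc_self, Finset.sum_empty]
    linarith
  | succ M hM ih =>
    rw [Finset.sum_Ioc_succ_top (by omega)]
    have hM0 : (0 : ℝ) < M := by exact_mod_cast (by omega : 0 < M)
    have h := Real.one_sub_inv_le_log_of_pos (x := (M + 1) / M) (by positivity)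
    rw [Real.log_div (by positivity) (by positivity), inv_div,
      one_sub_div (by positivity), add_sub_cancel_left, one_div] at h
    push_cast
    linarith

lemma abs_sumT_exp_sub_le {s t : ℝ} (hst : s ≤ t) :
    |sumT (Real.exp t) - sumT (Real.exp s)| ≤ (t - s) + Real.exp (-s) := by
  set N := ⌊Real.exp s⌋₊
  set M := ⌊Real.exp t⌋₊ with hMdef
  have hNM : N ≤ M := Nat.floor_le_floor (Real.exp_le_exp.2 hst)
  have hpos : 0 ≤ (t - s) + Real.exp (-s) := add_nonneg (by linarith) (Real.exp_pos _).le
  have hdiff : sumT (Real.exp t) - sumT (Real.exp s) = ∑ n ∈ Finset.Ioc N M, paritySign n / n := by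
    have := Finset.sum_Ioc_consecutive (fun n : ℕ => paritySign n / n) (Nat.zero_le N) hNM
    change (∑ n ∈ Finset.Ioc 0 M, paritySign n / n) - ∑ n ∈ Finset.Ioc 0 N, paritySign n / n = _
    linarith
  rw [hdiff]
  rcases hNM.eq_or_lt with h | h
  · rw [h]; simpa using hpos
  have h1 : |∑ n ∈ Finset.Ioc N M, paritySign n / n| ≤ ∑ n ∈ Finset.Ioc N M, (n : ℝ)⁻¹ := by
    refine (Finset.abs_sum_le_sum_abs _ _).trans (Finset.sum_le_sum fun n _ => ?_)
    rw [abs_div, abs_paritySign, Nat.abs_cast, one_div]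
  have h2 := sum_Ioc_inv_le (Real.exp_pos s) (Nat.lt_floor_add_one (Real.exp s)) h
  have h3 : Real.log M ≤ t := by
    rw [Real.log_le_iff_le_exp (by exact_mod_cast (by omega : 0 < M))]
    exact Nat.floor_le (Real.exp_pos t).le
  rw [Real.log_exp, ← Real.exp_neg] at h2
  linarith

/-- The transform extends to `Re z ≥ 0` because `riemannZeta₁` has no zeros on `Re s ≥ 1` and the
pole of `ζ(2(z+1))` lies at `z = -1/2`. -/
lemma tendsto_sumT_exp : Tendsto (fun u => sumT (Real.exp u)) atTop (𝓝 0) := by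
  have hz2 : ∀ z : ℂ, 0 ≤ z.re → z + 1 ∈ {s : ℂ | 1 / 2 < s.re} := fun z hz => by
    simp only [mem_ofPred_eq, Complex.add_re, Complex.one_re]; linarith
  refine tendsto_zero_of_laplace_continuousOn (C := 4) (measurable_sumT.comp Real.measurable_exp)
    (fun t => abs_sumT_le _) (fun t ht => ?_) (fun s t hst => abs_sumT_exp_sub_le hst)
    (G := fun z => -((1 + (2 : ℂ) ^ (-z)) * riemannZeta (2 * (z + 1))) / riemannZeta₁ (z + 1))
    (ContinuousOn.div (ContinuousOn.neg (ContinuousOn.mul ?_ ?_)) ?_ ?_) fun z hz => ?_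
  · rw [sumT, Nat.floor_eq_zero.2 (Real.exp_lt_one_iff.2 ht)]
    simp
  · exact (continuous_const.add (Continuous.const_cpow continuous_neg
      (Or.inl two_ne_zero))).continuousOn
  · exact differentiableOn_riemannZeta_two_mul.continuousOn.comp (f := fun z : ℂ => z + 1)
      (by fun_prop) hz2
  · exact (differentiable_riemannZeta₁.continuous.comp (continuous_add_const 1)).continuousOn
  · intro z hz
    exact riemannZeta₁_ne_zero_of_one_le_re (by simpa using hz)
  · rw [eq_div_iff (riemannZeta₁_ne_zero_of_one_le_re (by simpa using hz.le)), mul_comm]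
    exact laplace_sumT hz

/-- The series of `paritySign n / n` converges to zero. -/
theorem tendsto_sum_paritySign_div :
    Tendsto (fun N : ℕ => ∑ n ∈ Finset.Icc 1 N, paritySign n / (n : ℝ)) atTop (𝓝 0) := by
  have h := tendsto_sumT_exp.comp (Real.tendsto_log_atTop.comp tendsto_natCast_atTop_atTop)
  refine h.congr' ?_
  filter_upwards [eventually_gt_atTop 0] with N hN
  simp only [Function.comp]
  rw [Real.exp_log (by exact_mod_cast hN), sumT_natCast]

/-- Abel summation, arranged so that after division by `N` the second term is a Cesàro mean of the
partial sums of `T`. -/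
lemma sum_paritySign_eq (N : ℕ) :
    ∑ n ∈ Finset.Icc 1 N, paritySign n = N * ∑ n ∈ Finset.Icc 1 N, paritySign n / n -
      ∑ k ∈ Finset.range N, ∑ n ∈ Finset.Icc 1 k, paritySign n / n := by
  induction N with
  | zero => simp
  | succ N ih =>
    rw [Finset.sum_Icc_succ_top (by omega), Finset.sum_Icc_succ_top (by omega),
      Finset.sum_range_succ, ih]
    have : ((N + 1 : ℕ) : ℝ) ≠ 0 := by positivity
    push_cast at this ⊢
    field_simp
    ring

theorem sumS_isLittleO : sumS =o[atTop] fun x : ℝ => x := by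
  have h1 := tendsto_sum_paritySign_div.sub tendsto_sum_paritySign_div.cesaro
  rw [sub_zero] at h1
  have h2 : (fun N : ℕ => ∑ n ∈ Finset.Icc 1 N, paritySign n) =o[atTop] fun N : ℕ => (N : ℝ) := by
    refine (Asymptotics.isLittleO_iff_tendsto' ?_).2 (h1.congr' ?_)
    · filter_upwards [eventually_gt_atTop 0] with N hN h0
      exact absurd h0 (by exact_mod_cast hN.ne')
    · filter_upwards [eventually_gt_atTop 0] with N hN
      have : (N : ℝ) ≠ 0 := by exact_mod_cast hN.ne'
      rw [sum_paritySign_eq]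
      field_simp
  refine (h2.comp_tendsto tendsto_nat_floor_atTop).trans_isBigO (Asymptotics.IsBigO.of_bound' ?_)
  filter_upwards [eventually_ge_atTop 0] with x hx
  simpa [abs_of_nonneg hx] using Nat.floor_le hx

lemma analyticAt_riemannZeta_two_mul {s : ℂ} (hs : 1 / 2 < s.re) :
    AnalyticAt ℂ (fun s => riemannZeta (2 * s)) s :=
  differentiableOn_riemannZeta_two_mul.analyticAt ((isOpen_halfPlane _).mem_nhds hs)

theorem riemannHypothesis_of_sumS_pos (h : ∀ x : ℝ, 5 ≤ x → 0 < sumS x) : RiemannHypothesis := by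
  -- For `x < 5` the trivial bound `|S(x)| ≤ ⌊x⌋` makes the shift by `5` enough for nonnegativity;
  -- it only adds `5 / z` to the transform.
  set B : ℝ → ℝ := fun u => sumS (Real.exp u) + 5 with hB
  have hBm : Measurable B := (measurable_sumS.comp Real.measurable_exp).add_const 5
  have hB0 : ∀ u, 0 ≤ B u := fun u => by
    rcases le_or_gt 5 (Real.exp u) with h5 | h5
    · have := h _ h5
      simp only [hB]; linarith
    · have h1 := (abs_le.1 (abs_sumS_le (Real.exp u))).1
      have h2 := Nat.floor_le (Real.exp_pos u).le
      simp only [hB]; linarith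
  have hBC : ∀ u, 0 < u → B u ≤ 6 * Real.exp (1 * u) := fun u hu => by
    have h1 := (abs_le.1 (abs_sumS_le (Real.exp u))).2
    have h2 := Nat.floor_le (Real.exp_pos u).le
    have h3 := Real.one_le_exp hu.le
    simp only [hB, one_mul]; linarith
  have hmem1 := fun σ (hσ : 1 < σ) => mem_integrableExpSet_laplaceMeasure hBm hB0 hBC hσ
  set m := complexMGF (fun u => -u) (laplaceMeasure B) with hm
  have hmeq (z : ℂ) (hz : 1 < z.re) :
      z * m z = LSeries (fun n => (paritySign n : ℂ)) z + 5 := by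
    have hz0 : z ≠ 0 := by rintro rfl; norm_num at hz
    have hzp : 0 < z.re := by linarith
    have hi2 := (integrableOn_cexp_neg hzp).const_mul 5
    have hi1 : IntegrableOn (fun u => (sumS (Real.exp u) : ℂ) * Complex.exp (-z * u)) (Ioi 0) := by
      have hd : IntegrableOn (fun u => Real.exp (-(z.re - 1) * u)) (Ioi 0) :=
        exp_neg_integrableOn_Ioi 0 (sub_pos.2 hz)
      have := measurable_sumS
      refine Integrable.mono' hd (by fun_prop) (ae_of_all _ fun u => ?_)
      rw [norm_mul, Complex.norm_real, Complex.norm_exp]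
      have e1 : |sumS (Real.exp u)| ≤ Real.exp u :=
        (abs_sumS_le _).trans (Nat.floor_le (Real.exp_pos u).le)
      refine (mul_le_mul_of_nonneg_right e1 (Real.exp_pos _).le).trans (le_of_eq ?_)
      rw [← Real.exp_add]
      congr 1
      simp
      ring
    have hs : ∀ u : ℝ, (B u : ℂ) * Complex.exp (-z * u) =
        (sumS (Real.exp u) : ℂ) * Complex.exp (-z * u) + 5 * Complex.exp (-z * u) := fun u => by
      simp only [hB]; push_cast; ring
    rw [hm, complexMGF_laplaceMeasure hBm hB0]
    simp_rw [hs]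
    rw [integral_add hi1 hi2, integral_const_mul, integral_Ioi_cexp_neg hzp, mul_add,
      laplace_sumS hz]
    field_simp
  have hmem : ∀ σ : ℝ, 1 / 2 < σ → σ ∈ integrableExpSet (fun u => -u) (laplaceMeasure B) := by
    intro σ hσ
    refine mem_integrableExpSet_of_analyticAt (by fun_prop) (ae_laplaceMeasure_nonpos B)
      (σ₁ := 1) hmem1 (H := fun z => (-((z - 1) * (1 + (2 : ℂ) ^ (1 - z)) * riemannZeta (2 * z)) /
        riemannZeta₁ z + 5) / z) (fun τ hτ => ?_) (fun τ hτ => ?_) hσ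
    · have a1 := analyticAt_riemannZeta_two_mul (s := τ) (by simpa using hτ)
      have a2 := differentiable_two_cpow.analyticAt τ
      have a3 := differentiable_riemannZeta₁.analyticAt τ
      have hτ0 : 0 < τ := by linarith
      exact AnalyticAt.div ((((((analyticAt_id.sub analyticAt_const).mul
        (analyticAt_const.add a2)).mul a1).neg).div a3 (riemannZeta₁_ofReal_ne_zero hτ0)).add
          analyticAt_const) analyticAt_id (by exact_mod_cast hτ0.ne')
    · have hτ' : 1 < (τ : ℂ).re := by simpa using hτ
      have hτ0 : (τ : ℂ) ≠ 0 := by exact_mod_cast (by linarith : τ ≠ 0)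
      rw [← riemannZeta₁_mul_LSeries_paritySign hτ', mul_div_cancel_left₀ _
        (riemannZeta₁_ne_zero_of_one_le_re hτ'.le), ← hmeq _ hτ', mul_div_cancel_left₀ _ hτ0]
  have hd := differentiableOn_complexMGF_of_forall_mem hmem
  refine riemannHypothesis_of_continuation (K := fun z => 5 - z * m z) (by fun_prop) fun s hs => ?_
  rw [hmeq s hs]
  linear_combination -riemannZeta₁_mul_LSeries_paritySign hs

theorem riemannHypothesis_of_sumT_neg (h : ∀ x : ℝ, 1 ≤ x → sumT x < 0) : RiemannHypothesis := by
  set B : ℝ → ℝ := fun u => -sumT (Real.exp u) with hB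
  have hBm : Measurable B := (measurable_sumT.comp Real.measurable_exp).neg
  have hB0 : ∀ u, 0 ≤ B u := fun u => by
    rcases le_or_gt 1 (Real.exp u) with h1 | h1
    · exact neg_nonneg.2 (h _ h1).le
    · simp [hB, sumT, Nat.floor_eq_zero.2 h1]
  have hBC : ∀ u, 0 < u → B u ≤ 4 * Real.exp (0 * u) := fun u _ => by
    simpa using (neg_le_abs _).trans (abs_sumT_le (Real.exp u))
  have hmem0 := fun σ (hσ : 0 < σ) => mem_integrableExpSet_laplaceMeasure hBm hB0 hBC hσ
  set m := complexMGF (fun u => -u) (laplaceMeasure B) with hm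
  have hmeq (z : ℂ) (hz : 0 < z.re) : riemannZeta₁ (z + 1) * m z =
      (1 + (2 : ℂ) ^ (-z)) * riemannZeta (2 * (z + 1)) := by
    rw [hm, complexMGF_laplaceMeasure hBm hB0, ← neg_inj, ← laplace_sumT hz]
    simp only [hB, Complex.ofReal_neg, neg_mul, integral_neg]
    ring
  -- The variable is shifted, `s = z + 1`, so `-1/2` corresponds to the critical line.
  have hmem : ∀ σ : ℝ, -1 / 2 < σ → σ ∈ integrableExpSet (fun u => -u) (laplaceMeasure B) := by
    intro σ hσ
    refine mem_integrableExpSet_of_analyticAt (by fun_prop) (ae_laplaceMeasure_nonpos B)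
      (σ₁ := 0) hmem0 (H := fun z => (1 + (2 : ℂ) ^ (-z)) * riemannZeta (2 * (z + 1)) /
        riemannZeta₁ (z + 1)) (fun τ hτ => ?_) (fun τ hτ => ?_) hσ
    · have hs : AnalyticAt ℂ (fun z : ℂ => z + 1) τ := analyticAt_id.add analyticAt_const
      have a1 : AnalyticAt ℂ (fun z : ℂ => riemannZeta (2 * (z + 1))) τ :=
        (analyticAt_riemannZeta_two_mul (s := (τ : ℂ) + 1) (by
          simp only [Complex.add_re, Complex.ofReal_re, Complex.one_re]; linarith)).comp
            (f := fun z : ℂ => z + 1) hs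
      have a2 : AnalyticAt ℂ (fun z : ℂ => (2 : ℂ) ^ (-z)) τ := by
        refine Differentiable.analyticAt (fun s => ?_) _
        exact DifferentiableAt.const_cpow (by fun_prop) (Or.inl two_ne_zero)
      have a3 : AnalyticAt ℂ (fun z : ℂ => riemannZeta₁ (z + 1)) τ :=
        (differentiable_riemannZeta₁.analyticAt ((τ : ℂ) + 1)).comp (f := fun z : ℂ => z + 1) hs
      have hne : riemannZeta₁ ((τ : ℂ) + 1) ≠ 0 := by
        have := riemannZeta₁_ofReal_ne_zero (σ := τ + 1) (by linarith)
        simpa using this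
      exact ((analyticAt_const.add a2).mul a1).div a3 hne
    · have hτ' : 0 < (τ : ℂ).re := by simpa using hτ
      rw [← hmeq _ hτ', mul_div_cancel_left₀ _
        (riemannZeta₁_ne_zero_of_one_le_re (by simpa using hτ'.le))]
  have hd := differentiableOn_complexMGF_of_forall_mem hmem
  have hd' : DifferentiableOn ℂ (fun s => m (s - 1)) {z | 1 / 2 < z.re} :=
    hd.comp (f := fun s : ℂ => s - 1) (by fun_prop) fun s hs => by
      have : 1 / 2 < s.re := hs
      simp only [mem_ofPred_eq, Complex.sub_re, Complex.one_re]; linarith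
  refine riemannHypothesis_of_continuation (K := fun s => (s - 1) * m (s - 1))
    ((differentiableOn_id.sub_const 1).mul hd') fun s hs => ?_
  have := hmeq (s - 1) (by simpa using hs)
  rw [sub_add_cancel, neg_sub] at this
  linear_combination (s - 1) * this

end

theorem theorem1p5 :
    (sumS =o[Filter.atTop] (fun x : ℝ => x) ∧
      Filter.Tendsto (fun N : ℕ => ∑ n ∈ Finset.Icc 1 N, paritySign n / (n : ℝ))
        Filter.atTop (nhds 0)) ∧
    (((∀ x : ℝ, 5 ≤ x → 0 < sumS x) ∨ (∀ x : ℝ, 1 ≤ x → sumT x < 0)) →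
      RiemannHypothesis) :=
  ⟨⟨sumS_isLittleO, tendsto_sum_paritySign_div⟩, fun h =>
    h.elim riemannHypothesis_of_sumS_pos riemannHypothesis_of_sumT_neg⟩
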